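/- Let $\Sigma$ be a finite linearly ordered alphabet and order $\Sigma^*$ by the radix (length-lexicographic) order: $u<v$ if $|u|<|v|$, or if $|u|=|v|$ and $u$ is lexicographically smaller than $v$. For $L\subseteq\Sigma^*$ and $u\in\Sigma^*$, the $L$-successor of $u$ is the smallest word $v\in L$ with $u<v$, if there is one. A finite-state transducer is a nondeterministic finite automaton, with one initial state and a set of accepting states, each of whose transitions reads one letter or the empty word and writes one letter or the empty word. It maps $u$ to $v$ if it has an accepting run that reads $u$ and writes $v$, and it is unambiguous if every input word has at most one accepting run. Theorem. There is a function $f:\mathbb N\to\mathbb R$ with $f(n)=O(\sqrt{n\log n})$ as $n\to\infty$ such that the following holds. For every finite ordered alphabet $\Sigma$ and every complete deterministic finite automaton $\mathcal A$ over $\Sigma$ with $n$ states, there is an unambiguous finite-state transducer with input and output alphabet $\Sigma$ and at most $2^{f(n)}$ states that maps every word $u\in\Sigma^*$ which has an $L(\mathcal A)$-successor to exactly that successor, and that has no accepting run on words without an $L(\mathcal A)$-successor. -/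

import Mathlib

/-- A (nondeterministic) transducer with input alphabet `α`, output alphabet `β` and state set `σ`.
`(q, b) ∈ step p a` is a transition from `p` to `q` that reads `a` and writes `b`, where `none`
stands for the empty word `ε`, both on the input and on the output side. Finiteness of the state
set and of the alphabets is imposed where the structure is used. -/
structure Transducer (α β σ : Type*) where
  /-- The transition function. -/
  step : σ → Option α → Set (σ × Option β)
  /-- The initial state. -/
  start : σ
  /-- The set of accepting states. -/
  accept : Set σ

namespace Transducer

/-- `T.AcceptingFrom p r`: the sequence `r` of transitions is a path of `T` that starts in `p` and
ends in an accepting state. A transition is recorded as `(a, b, q)`: letter (or `ε`) read, letter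
(or `ε`) written, and the state reached. -/
def AcceptingFrom {α β σ : Type*} (T : Transducer α β σ) :
    σ → List (Option α × Option β × σ) → Prop
  | p, [] => p ∈ T.accept
  | p, (a, b, q) :: r => (q, b) ∈ T.step p a ∧ T.AcceptingFrom q r

/-- An accepting run: a path from the initial state to an accepting state. -/
def AcceptingRun {α β σ : Type*} (T : Transducer α β σ)
    (r : List (Option α × Option β × σ)) : Prop :=
  T.AcceptingFrom T.start r

/-- The input word that a sequence of transitions reads. -/
def inputWord {α β σ : Type*} (r : List (Option α × Option β × σ)) : List α :=
  r.filterMap fun t => t.1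

/-- The output word that a sequence of transitions writes. -/
def outputWord {α β σ : Type*} (r : List (Option α × Option β × σ)) : List β :=
  r.filterMap fun t => t.2.1

/-- `T` is unambiguous: every input word has at most one accepting run. -/
def Unambiguous {α β σ : Type*} (T : Transducer α β σ) : Prop :=
  ∀ r r' : List (Option α × Option β × σ), T.AcceptingRun r → T.AcceptingRun r' →
    inputWord r = inputWord r' → r = r'

/-- `T` maps the input word `u` to the output word `v`: some accepting run reads `u` and
writes `v`. -/
def MapsWord {α β σ : Type*} (T : Transducer α β σ) (u : List α) (v : List β) : Prop :=
  ∃ r : List (Option α × Option β × σ), T.AcceptingRun r ∧ inputWord r = u ∧ outputWord r = v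

end Transducer

/-- Radix (length-lexicographical) order on words: shorter words first, words of the same length
in lexicographical order. -/
def RadixLT {α : Type*} [LinearOrder α] (u v : List α) : Prop :=
  List.Shortlex (fun a b : α => a < b) u v

/-- `v` is the `L`-successor of `u`: the smallest word of `L` that is larger than `u` in the radix
order. -/
def IsSuccessor {α : Type*} [LinearOrder α] (L : Language α) (u v : List α) : Prop :=
  v ∈ L ∧ RadixLT u v ∧ ∀ w : List α, RadixLT u w → RadixLT w v → w ∉ L

/-! The successor of a word can be written letter by letter once it is known, after each letter,
from which states of `A` some word of the remaining length `k` is accepted, that is, the set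
`A.level k`. The transducer guesses this set. A level is the preimage of the next one, and the last
guess must be `A.accept`, so acceptance forces every guess to be right (`split_spec`, `tied_spec`,
`pad_spec`); this gives correctness and unambiguity. If the successor is longer than the input, its
excess letters are written before reading starts. Besides the guess a state stores at most two
states of `A`, so with `n` states in `A` there are O(n²) transducer states per distinct level.

To count levels, let `P > 0` be such that every state on a nonempty loop has a loop of length
exactly `P`. A word of length `k ≥ n` repeats a state, so `level k ⊆ level (k + P)`: the levels with
`k ≥ n` in one residue class mod `P` form a chain of at most `n + 1` sets. A suitable `P` is `2n`
times a common multiple of one loop length per strongly connected component. Components of at most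
`B` states contribute a divisor of lcm(1, ..., B) = exp(ψ(B)) = exp(O(B)); the fewer than `n / B +
1` larger ones contribute at most `n` each. Taking `B` near √(n log n) balances `B` against (n / B)
log n. -/

namespace DFA

/-! ### Recursive descriptions of least and next words -/

section Specifications

variable {α σ : Type*} (A : DFA α σ)

/-- The states from which `A` accepts some word of length `k`. -/
def level (k : ℕ) : Set σ := {q | ∃ w : List α, w.length = k ∧ A.evalFrom q w ∈ A.accept}

/-- The states with a transition into `S`. -/
def pre (S : Set σ) : Set σ := {q | ∃ a, A.step q a ∈ S}

theorem mem_level {k : ℕ} {q : σ} :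
    q ∈ A.level k ↔ ∃ w : List α, w.length = k ∧ A.evalFrom q w ∈ A.accept := Iff.rfl

@[simp] theorem level_zero : A.level 0 = A.accept := by
  ext q; simp [mem_level, List.length_eq_zero_iff]

theorem level_succ (k : ℕ) : A.level (k + 1) = A.pre (A.level k) := by
  ext q
  constructor
  · rintro ⟨_ | ⟨a, w⟩, h, hw⟩
    · simp at h
    · exact ⟨a, w, by simpa using h, hw⟩
  · rintro ⟨a, w, h, hw⟩
    exact ⟨a :: w, by simpa using h, hw⟩

variable [LinearOrder α]

/-- `c` is the least letter that leads from `p` into `S`. -/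
def IsLeastLetter (S : Set σ) (p : σ) (c : α) : Prop :=
  A.step p c ∈ S ∧ ∀ c' < c, A.step p c' ∉ S

/-- `y` is the least word of its length that is accepted from `p`. -/
def IsLeastWord (p : σ) (y : List α) : Prop :=
  A.evalFrom p y ∈ A.accept ∧
    ∀ z : List α, z.length = y.length → List.Lex (· < ·) z y → A.evalFrom p z ∉ A.accept

/-- No word of the length of `x` that is larger than `x` is accepted from `q`. -/
def NoneAbove (q : σ) (x : List α) : Prop :=
  ∀ z : List α, z.length = x.length → List.Lex (· < ·) x z → A.evalFrom q z ∉ A.accept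

/-- `y` is the least word larger than `x` among the words of the length of `x` accepted
from `q`. -/
def IsNextWord (q : σ) (x y : List α) : Prop :=
  y.length = x.length ∧ A.evalFrom q y ∈ A.accept ∧ List.Lex (· < ·) x y ∧
    ∀ z : List α, z.length = x.length → List.Lex (· < ·) x z → List.Lex (· < ·) z y →
      A.evalFrom q z ∉ A.accept

variable {A}

theorem IsLeastLetter.unique {S : Set σ} {p : σ} {c c' : α} (h : A.IsLeastLetter S p c)
    (h' : A.IsLeastLetter S p c') : c = c' :=
  le_antisymm (not_lt.1 fun hlt => h.2 _ hlt h'.1) (not_lt.1 fun hlt => h'.2 _ hlt h.1)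

@[simp] theorem isLeastWord_nil {p : σ} : A.IsLeastWord p [] ↔ p ∈ A.accept := by
  simp [IsLeastWord]

theorem isLeastWord_cons {p : σ} {c : α} {y : List α} :
    A.IsLeastWord p (c :: y) ↔
      A.IsLeastLetter (A.level y.length) p c ∧ A.IsLeastWord (A.step p c) y := by
  constructor
  · rintro ⟨h1, h2⟩
    refine ⟨⟨⟨y, rfl, h1⟩, ?_⟩, h1, ?_⟩
    · rintro c' hc ⟨z, hz, hz'⟩
      exact h2 (c' :: z) (by simp [hz]) (.rel hc) hz'
    · intro z hz hlt
      exact h2 (c :: z) (by simp [hz]) (.cons hlt)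
  · rintro ⟨⟨_, h2⟩, h3, h4⟩
    refine ⟨h3, ?_⟩
    rintro (_ | ⟨a, z⟩) hz hlt
    · simp at hz
    · rcases List.cons_lex_cons_iff.1 hlt with h | ⟨rfl, h⟩
      · exact fun hacc => h2 a h ⟨z, by simpa using hz, hacc⟩
      · exact h4 z (by simpa using hz) h

theorem IsLeastWord.mem_level {p : σ} {y : List α} (h : A.IsLeastWord p y) :
    p ∈ A.level y.length := ⟨y, rfl, h.1⟩

@[simp] theorem noneAbove_nil {q : σ} : A.NoneAbove q [] := by
  intro z hz hlt
  simp_all [List.length_eq_zero_iff]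

theorem noneAbove_cons {q : σ} {a : α} {x : List α} :
    A.NoneAbove q (a :: x) ↔
      (∀ b, a < b → A.step q b ∉ A.level x.length) ∧ A.NoneAbove (A.step q a) x := by
  constructor
  · intro h
    refine ⟨?_, ?_⟩
    · rintro b hb ⟨z, hz, hz'⟩
      exact h (b :: z) (by simp [hz]) (.rel hb) hz'
    · intro z hz hlt
      exact h (a :: z) (by simp [hz]) (.cons hlt)
  · rintro ⟨h1, h2⟩ (_ | ⟨b, z⟩) hz hlt
    · simp at hz
    · rcases List.cons_lex_cons_iff.1 hlt with h | ⟨rfl, h⟩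
      · exact fun hacc => h1 b h ⟨z, by simpa using hz, hacc⟩
      · exact h2 z (by simpa using hz) h

theorem IsNextWord.not_noneAbove {q : σ} {x y : List α} (h : A.IsNextWord q x y) :
    ¬ A.NoneAbove q x := fun h' => h' y h.1 h.2.2.1 h.2.1

theorem not_isNextWord_nil {q : σ} {y : List α} : ¬ A.IsNextWord q [] y := fun h =>
  h.not_noneAbove noneAbove_nil

/-- At the first difference the output takes the least viable letter above `a`. Staying with `a`
must be hopeless, so the rest of the input has nothing above it, and the rest of the output is
least. -/
theorem isNextWord_cons {q : σ} {a b : α} {x y : List α} :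
    A.IsNextWord q (a :: x) (b :: y) ↔
      (a = b ∧ A.IsNextWord (A.step q a) x y) ∨
      (a < b ∧ A.step q b ∈ A.level x.length ∧
        (∀ c, a < c → c < b → A.step q c ∉ A.level x.length) ∧ y.length = x.length ∧
        A.NoneAbove (A.step q a) x ∧ A.IsLeastWord (A.step q b) y) := by
  constructor
  · rintro ⟨hl, h1, hlt, h2⟩
    have hl' : y.length = x.length := by simpa using hl
    rcases List.cons_lex_cons_iff.1 hlt with h | ⟨rfl, h⟩
    · refine .inr ⟨h, ⟨y, hl', h1⟩, ?_, hl', ?_, h1, ?_⟩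
      · rintro c hac hcb ⟨z, hz, hz'⟩
        exact h2 (c :: z) (by simp [hz]) (.rel hac) (.rel hcb) hz'
      · intro z hz hxz
        exact h2 (a :: z) (by simp [hz]) (.cons hxz) (.rel h)
      · intro z hz hzy
        exact h2 (b :: z) (by simp [hz, hl']) (.rel h) (.cons hzy)
    · refine .inl ⟨rfl, hl', h1, h, ?_⟩
      intro z hz hxz hzy
      exact h2 (a :: z) (by simp [hz]) (.cons hxz) (.cons hzy)
  · rintro (⟨rfl, hl, h1, hlt, h2⟩ | ⟨hab, _, h1, hl, h2, h3, h4⟩)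
    · refine ⟨by simp [hl], h1, .cons hlt, ?_⟩
      rintro (_ | ⟨c, z⟩) hz hxz hzy
      · simp at hz
      · rcases List.cons_lex_cons_iff.1 hxz with h | ⟨rfl, h⟩
        · rcases List.cons_lex_cons_iff.1 hzy with h' | ⟨rfl, h'⟩
          · exact absurd h h'.asymm
          · exact absurd h (lt_irrefl _)
        · rcases List.cons_lex_cons_iff.1 hzy with h' | ⟨-, h'⟩
          · exact absurd h' (lt_irrefl _)
          · exact h2 z (by simpa using hz) h h'
    · refine ⟨by simp [hl], h3, .rel hab, ?_⟩
      rintro (_ | ⟨c, z⟩) hz hxz hzy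
      · simp at hz
      · have hz' : z.length = x.length := by simpa using hz
        rcases List.cons_lex_cons_iff.1 hxz with h | ⟨rfl, h⟩
        · rcases List.cons_lex_cons_iff.1 hzy with h' | ⟨rfl, h'⟩
          · exact fun hacc => h1 c h h' ⟨z, hz', hacc⟩
          · exact h4 z (hz'.trans hl.symm) h'
        · exact h2 z hz' h

theorem isSuccessor_iff {u v : List α} :
    IsSuccessor A.accepts u v ↔ A.IsNextWord A.start u v ∨
      (A.NoneAbove A.start u ∧ A.IsLeastWord A.start v ∧ u.length < v.length ∧
        ∀ k, u.length < k → k < v.length → A.start ∉ A.level k) := by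
  have hmem (w : List α) : w ∈ A.accepts ↔ A.evalFrom A.start w ∈ A.accept := Iff.rfl
  simp only [IsSuccessor, RadixLT, List.shortlex_def, hmem]
  constructor
  · rintro ⟨h1, hlt | ⟨hl, hlt⟩, h2⟩
    · refine .inr ⟨?_, ⟨h1, ?_⟩, hlt, ?_⟩
      · exact fun z hz hz' => h2 z (.inr ⟨hz.symm, hz'⟩) (.inl (hz ▸ hlt))
      · exact fun z hz hz' => h2 z (.inl (hz ▸ hlt)) (.inr ⟨hz, hz'⟩)
      · rintro k hk hk' ⟨w, rfl, hw⟩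
        exact h2 w (.inl hk) (.inl hk') hw
    · exact .inl ⟨hl.symm, h1, hlt, fun z hz hxz hzy =>
        h2 z (.inr ⟨hz.symm, hxz⟩) (.inr ⟨hz.trans hl, hzy⟩)⟩
  · rintro (⟨hl, h1, hlt, h2⟩ | ⟨h1, ⟨h2, h3⟩, hlt, h4⟩)
    · refine ⟨h1, .inr ⟨hl.symm, hlt⟩, ?_⟩
      rintro w (h | ⟨h, hw⟩) (h' | ⟨h', hw'⟩)
      · omega
      · omega
      · omega
      · exact h2 w h.symm hw hw'
    · refine ⟨h2, .inl hlt, ?_⟩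
      rintro w (h | ⟨h, hw⟩) (h' | ⟨h', hw'⟩)
      · exact fun hacc => h4 _ h h' ⟨w, rfl, hacc⟩
      · exact h3 w h' hw'
      · exact h1 w h.symm hw
      · omega

end Specifications

/-! ### The successor transducer -/

section Construction

variable {α σ : Type*} (A : DFA α σ)

/-- The finitely many sets of the form `A.level k`. -/
abbrev Level : Type _ := Set.range A.level

/-- The `k`-th level as an element of `A.Level`. -/
def toLevel (k : ℕ) : A.Level := ⟨A.level k, k, rfl⟩

theorem toLevel_succ (k : ℕ) : (A.toLevel (k + 1)).1 = A.pre (A.toLevel k).1 := A.level_succ k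

/-- The states of the successor transducer. The component in `A.Level` represents the number of
letters that are still to be written. -/
inductive SuccState
  /-- The initial state. -/
  | start
  /-- Nothing has been read yet, and `A` is in state `p` after the word written. -/
  | pad (S : A.Level) (p : σ)
  /-- The words read and written agree, and lead `A` to the state `q`. -/
  | tied (S : A.Level) (q : σ)
  /-- The word read is smaller than the word written; they lead `A` to `q` and `p`. -/
  | split (S : A.Level) (q p : σ)

variable [LinearOrder α]

/-- The transitions of the successor transducer. -/
inductive SuccStep : A.SuccState → Option α → A.SuccState → Option α → Prop
  | startTied (S) : SuccStep .start none (.tied S A.start) none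
  | startPad (S : A.Level) (h : A.start ∈ S.1) : SuccStep .start none (.pad S A.start) none
  -- Padding continues only while the remaining output is longer than the input; the condition `h`
  -- rules out that shorter length for the successor.
  | padPad {S S' : A.Level} {p c} (hS : S.1 = A.pre S'.1) (hc : A.IsLeastLetter S'.1 p c)
      (h : A.start ∉ S'.1) : SuccStep (.pad S p) none (.pad S' (A.step p c)) (some c)
  | padSplit {S S' : A.Level} {p c} (hS : S.1 = A.pre S'.1) (hc : A.IsLeastLetter S'.1 p c) :
      SuccStep (.pad S p) none (.split S' A.start (A.step p c)) (some c)
  | tiedTied {S S' : A.Level} {q a} (hS : S.1 = A.pre S'.1) :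
      SuccStep (.tied S q) (some a) (.tied S' (A.step q a)) (some a)
  | tiedSplit {S S' : A.Level} {q a b} (hS : S.1 = A.pre S'.1) (hab : a < b)
      (hb : A.step q b ∈ S'.1) (h : ∀ c, a < c → c < b → A.step q c ∉ S'.1) :
      SuccStep (.tied S q) (some a) (.split S' (A.step q a) (A.step q b)) (some b)
  | splitSplit {S S' : A.Level} {q p a c} (hS : S.1 = A.pre S'.1)
      (hc : A.IsLeastLetter S'.1 p c) (h : ∀ b, a < b → A.step q b ∉ S'.1) :
      SuccStep (.split S q p) (some a) (.split S' (A.step q a) (A.step p c)) (some c)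

/-- The transducer that computes the successor of a word in the language of `A`. -/
def succTransducer : Transducer α α A.SuccState where
  step s a := {t | A.SuccStep s a t.1 t.2}
  start := .start
  accept := {s | ∃ S q p, s = .split S q p ∧ S.1 = A.accept ∧ p ∈ A.accept}

end Construction

/-! ### Correctness and unambiguity -/

section Runs

open Transducer

variable {α σ : Type*} [LinearOrder α] {A : DFA α σ}

/-- Induction from the end of the run: acceptance fixes the last guess, and each transition then
fixes the guess before it. -/
theorem split_spec {S : A.Level} {q p : σ} {r : List (Option α × Option α × A.SuccState)}
    (h : A.succTransducer.AcceptingFrom (.split S q p) r) :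
    S.1 = A.level (inputWord r).length ∧ (outputWord r).length = (inputWord r).length ∧
      A.NoneAbove q (inputWord r) ∧ A.IsLeastWord p (outputWord r) := by
  induction r generalizing S q p with
  | nil =>
    obtain ⟨S', q', p', h, h1, h2⟩ := h
    cases h
    simpa [inputWord, outputWord] using ⟨h1, h2⟩
  | cons t r ih =>
    obtain ⟨a, b, s⟩ := t
    obtain ⟨h1, h2⟩ := h
    cases h1 with
    | @splitSplit S S' q p a c hS hc h =>
      obtain ⟨e1, e2, e3, e4⟩ := ih h2
      rw [e1] at hS hc h
      have hi : inputWord ((some a, some c, SuccState.split S' (A.step q a) (A.step p c)) :: r) =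
        a :: inputWord r := rfl
      have ho : outputWord ((some a, some c, SuccState.split S' (A.step q a) (A.step p c)) :: r) =
        c :: outputWord r := rfl
      rw [hi, ho, noneAbove_cons, isLeastWord_cons, e2]
      exact ⟨hS.trans (A.level_succ _).symm, by simp [e2], ⟨h, e3⟩, hc, e4⟩

theorem split_unique {S : A.Level} {q p : σ} {r r' : List (Option α × Option α × A.SuccState)}
    (h : A.succTransducer.AcceptingFrom (.split S q p) r)
    (h' : A.succTransducer.AcceptingFrom (.split S q p) r') (hi : inputWord r = inputWord r') :
    r = r' := by
  induction r generalizing S q p r' with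
  | nil =>
    rcases r' with _ | ⟨⟨a, b, s⟩, r'⟩
    · rfl
    · cases h'.1
      simp [inputWord] at hi
  | cons t r ih =>
    obtain ⟨a, b, s⟩ := t
    obtain ⟨h1, h2⟩ := h
    rcases r' with _ | ⟨⟨a', b', s'⟩, r'⟩
    · cases h1
      simp [inputWord] at hi
    · obtain ⟨h1', h2'⟩ := h'
      cases h1 with
      | @splitSplit S S1 q p a c hS hc h =>
        cases h1' with
        | @splitSplit _ S2 _ _ a' c' hS' hc' h' =>
          obtain ⟨rfl, hw⟩ : a = a' ∧ inputWord r = inputWord r' := by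
            simpa [inputWord] using hi
          obtain rfl : S1 = S2 := Subtype.ext (by
            rw [(split_spec h2).1, (split_spec h2').1, hw])
          obtain rfl := hc.unique hc'
          rw [ih h2 h2' hw]

theorem exists_split {q p : σ} {x y : List α} (hl : y.length = x.length)
    (hx : A.NoneAbove q x) (hy : A.IsLeastWord p y) :
    ∃ r, A.succTransducer.AcceptingFrom (.split (A.toLevel x.length) q p) r ∧
      inputWord r = x ∧ outputWord r = y := by
  induction x generalizing q p y with
  | nil =>
    obtain rfl : y = [] := by simpa [List.length_eq_zero_iff] using hl
    exact ⟨[], ⟨_, _, _, rfl, A.level_zero, by simpa using hy⟩, rfl, rfl⟩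
  | cons a x ih =>
    rcases y with _ | ⟨c, y⟩
    · simp at hl
    · have hl' : y.length = x.length := by simpa using hl
      rw [noneAbove_cons] at hx
      rw [isLeastWord_cons, hl'] at hy
      obtain ⟨r, h1, rfl, rfl⟩ := ih hl' hx.2 hy.2
      exact ⟨(some a, some c, _) :: r, ⟨.splitSplit (A.toLevel_succ _) hy.1 hx.1, h1⟩, rfl, rfl⟩

theorem tied_spec {S : A.Level} {q : σ} {r : List (Option α × Option α × A.SuccState)}
    (h : A.succTransducer.AcceptingFrom (.tied S q) r) :
    S.1 = A.level (inputWord r).length ∧ A.IsNextWord q (inputWord r) (outputWord r) := by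
  induction r generalizing S q with
  | nil =>
    obtain ⟨S', q', p', h, -⟩ := h
    cases h
  | cons t r ih =>
    obtain ⟨a, b, s⟩ := t
    obtain ⟨h1, h2⟩ := h
    cases h1 with
    | @tiedTied S S' q a hS =>
      obtain ⟨e1, e2⟩ := ih h2
      rw [e1] at hS
      exact ⟨hS.trans (A.level_succ _).symm, isNextWord_cons.2 (.inl ⟨rfl, e2⟩)⟩
    | @tiedSplit S S' q a b hS hab hb h =>
      obtain ⟨e1, e2, e3, e4⟩ := split_spec h2
      rw [e1] at hS hb h
      exact ⟨hS.trans (A.level_succ _).symm,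
        isNextWord_cons.2 (.inr ⟨hab, hb, h, e2, e3, e4⟩)⟩

theorem tied_unique {S : A.Level} {q : σ} {r r' : List (Option α × Option α × A.SuccState)}
    (h : A.succTransducer.AcceptingFrom (.tied S q) r)
    (h' : A.succTransducer.AcceptingFrom (.tied S q) r') (hi : inputWord r = inputWord r') :
    r = r' := by
  induction r generalizing S q r' with
  | nil =>
    obtain ⟨S', q', p', h, -⟩ := h
    cases h
  | cons t r ih =>
    obtain ⟨a, b, s⟩ := t
    obtain ⟨h1, h2⟩ := h
    rcases r' with _ | ⟨⟨a', b', s'⟩, r'⟩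
    · obtain ⟨S', q', p', h', -⟩ := h'
      cases h'
    · obtain ⟨h1', h2'⟩ := h'
      cases h1 with
      | @tiedTied S S1 q a hS =>
        cases h1' with
        | @tiedTied _ S2 _ a' hS' =>
          obtain ⟨rfl, hw⟩ : a = a' ∧ inputWord r = inputWord r' := by
            simpa [inputWord] using hi
          obtain rfl : S1 = S2 := Subtype.ext (by
            rw [(tied_spec h2).1, (tied_spec h2').1, hw])
          rw [ih h2 h2' hw]
        | @tiedSplit _ S2 _ a' b' hS' hab' hb' h' =>
          -- Staying tied needs a larger word above the remaining input, splitting needs that there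
          -- is none.
          obtain ⟨rfl, hw⟩ : a = a' ∧ inputWord r = inputWord r' := by
            simpa [inputWord] using hi
          exact absurd (hw ▸ (split_spec h2').2.2.1) (tied_spec h2).2.not_noneAbove
      | @tiedSplit S S1 q a b hS hab hb h =>
        cases h1' with
        | @tiedTied _ S2 _ a' hS' =>
          obtain ⟨rfl, hw⟩ : a = a' ∧ inputWord r = inputWord r' := by
            simpa [inputWord] using hi
          exact absurd (hw ▸ (split_spec h2).2.2.1) (tied_spec h2').2.not_noneAbove
        | @tiedSplit _ S2 _ a' b' hS' hab' hb' h' =>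
          obtain ⟨rfl, hw⟩ : a = a' ∧ inputWord r = inputWord r' := by
            simpa [inputWord] using hi
          obtain rfl : S1 = S2 := Subtype.ext (by
            rw [(split_spec h2).1, (split_spec h2').1, hw])
          obtain rfl : b = b' := le_antisymm
            (not_lt.1 fun hlt => h _ hab' hlt hb') (not_lt.1 fun hlt => h' _ hab hlt hb)
          rw [split_unique h2 h2' hw]

theorem exists_tied {q : σ} {x y : List α} (h : A.IsNextWord q x y) :
    ∃ r, A.succTransducer.AcceptingFrom (.tied (A.toLevel x.length) q) r ∧
      inputWord r = x ∧ outputWord r = y := by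
  induction x generalizing q y with
  | nil => exact absurd h not_isNextWord_nil
  | cons a x ih =>
    rcases y with _ | ⟨b, y⟩
    · simpa using h.1
    · rcases isNextWord_cons.1 h with ⟨rfl, hn⟩ | ⟨hab, hb, hn, hl, h1, h2⟩
      · obtain ⟨r, h1, rfl, rfl⟩ := ih hn
        exact ⟨(some a, some a, _) :: r, ⟨.tiedTied (A.toLevel_succ _), h1⟩, rfl, rfl⟩
      · obtain ⟨r, h3, rfl, rfl⟩ := exists_split hl h1 h2
        exact ⟨(some a, some b, _) :: r, ⟨.tiedSplit (A.toLevel_succ _) hab hb hn, h3⟩, rfl, rfl⟩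

theorem pad_spec {S : A.Level} {p : σ} {r : List (Option α × Option α × A.SuccState)}
    (h : A.succTransducer.AcceptingFrom (.pad S p) r) :
    S.1 = A.level (outputWord r).length ∧ (inputWord r).length < (outputWord r).length ∧
      A.NoneAbove A.start (inputWord r) ∧ A.IsLeastWord p (outputWord r) ∧
      ∀ k, (inputWord r).length < k → k < (outputWord r).length → A.start ∉ A.level k := by
  induction r generalizing S p with
  | nil =>
    obtain ⟨S', q', p', h, -⟩ := h
    cases h
  | cons t r ih =>
    obtain ⟨a, b, s⟩ := t
    obtain ⟨h1, h2⟩ := h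
    cases h1 with
    | @padPad S S' p c hS hc h =>
      obtain ⟨e1, e2, e3, e4, e5⟩ := ih h2
      rw [e1] at hS hc h
      refine ⟨hS.trans (A.level_succ _).symm, e2.trans (Nat.lt_succ_self _), e3,
        isLeastWord_cons.2 ⟨hc, e4⟩, fun k hk hk' => ?_⟩
      rcases Nat.lt_succ_iff_lt_or_eq.1 hk' with hk' | rfl
      · exact e5 k hk hk'
      · exact h
    | @padSplit S S' p c hS hc =>
      obtain ⟨e1, e2, e3, e4⟩ := split_spec h2
      rw [e1, ← e2] at hS hc
      refine ⟨hS.trans (A.level_succ _).symm, e2 ▸ Nat.lt_succ_self _, e3,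
        isLeastWord_cons.2 ⟨hc, e4⟩, fun k hk hk' => ?_⟩
      have hk1 : (inputWord r).length < k := hk
      have hk2 : k < (outputWord r).length + 1 := hk'
      omega

/-- A state records a level, and different lengths may share one, so the output length has to be
prescribed here. -/
theorem pad_unique {S : A.Level} {p : σ} {r r' : List (Option α × Option α × A.SuccState)}
    (h : A.succTransducer.AcceptingFrom (.pad S p) r)
    (h' : A.succTransducer.AcceptingFrom (.pad S p) r') (hi : inputWord r = inputWord r')
    (ho : (outputWord r).length = (outputWord r').length) : r = r' := by
  induction r generalizing S p r' with
  | nil =>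
    obtain ⟨S', q', p', h, -⟩ := h
    cases h
  | cons t r ih =>
    obtain ⟨a, b, s⟩ := t
    obtain ⟨h1, h2⟩ := h
    rcases r' with _ | ⟨⟨a', b', s'⟩, r'⟩
    · obtain ⟨S', q', p', h', -⟩ := h'
      cases h'
    · obtain ⟨h1', h2'⟩ := h'
      cases h1 with
      | @padPad S S1 p c hS hc h =>
        cases h1' with
        | @padPad _ S2 _ c' hS' hc' h' =>
          replace hi : inputWord r = inputWord r' := hi
          replace ho : (outputWord r).length = (outputWord r').length := Nat.succ.inj ho
          obtain rfl : S1 = S2 := Subtype.ext (by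
            rw [(pad_spec h2).1, (pad_spec h2').1, ho])
          obtain rfl := hc.unique hc'
          rw [ih h2 h2' hi ho]
        | @padSplit _ S2 _ c' hS' hc' =>
          replace hi : inputWord r = inputWord r' := hi
          replace ho : (outputWord r).length = (outputWord r').length := Nat.succ.inj ho
          have h3 := (pad_spec h2).2.1
          have h4 := (split_spec h2').2.1
          rw [hi, ho] at h3
          omega
      | @padSplit S S1 p c hS hc =>
        cases h1' with
        | @padPad _ S2 _ c' hS' hc' h' =>
          replace hi : inputWord r = inputWord r' := hi
          replace ho : (outputWord r).length = (outputWord r').length := Nat.succ.inj ho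
          have h3 := (pad_spec h2').2.1
          have h4 := (split_spec h2).2.1
          rw [hi, ho] at h4
          omega
        | @padSplit _ S2 _ c' hS' hc' =>
          replace hi : inputWord r = inputWord r' := hi
          obtain rfl : S1 = S2 := Subtype.ext (by
            rw [(split_spec h2).1, (split_spec h2').1, hi])
          obtain rfl := hc.unique hc'
          rw [split_unique h2 h2' hi]

theorem exists_pad {p : σ} {x y : List α} (hx : A.NoneAbove A.start x) (hy : A.IsLeastWord p y)
    (hl : x.length < y.length)
    (h : ∀ k, x.length < k → k < y.length → A.start ∉ A.level k) :
    ∃ r, A.succTransducer.AcceptingFrom (.pad (A.toLevel y.length) p) r ∧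
      inputWord r = x ∧ outputWord r = y := by
  induction y generalizing p with
  | nil => simp at hl
  | cons c y ih =>
    rw [isLeastWord_cons] at hy
    rcases Nat.lt_succ_iff_lt_or_eq.1 hl with hl' | hl'
    · obtain ⟨r, h1, rfl, rfl⟩ := ih hy.2 hl' fun k hk hk' => h k hk (hk'.trans (Nat.lt_succ_self _))
      exact ⟨(none, some c, _) :: r, ⟨.padPad (A.toLevel_succ _) hy.1 (h _ hl' (Nat.lt_succ_self _)),
        h1⟩, rfl, rfl⟩
    · obtain ⟨r, h1, rfl, rfl⟩ := exists_split hl'.symm hx hy.2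
      rw [hl'] at h1
      exact ⟨(none, some c, _) :: r, ⟨.padSplit (A.toLevel_succ _) hy.1, h1⟩, rfl, rfl⟩

theorem mapsWord_succTransducer {u v : List α} :
    A.succTransducer.MapsWord u v ↔ IsSuccessor A.accepts u v := by
  rw [isSuccessor_iff]
  constructor
  · rintro ⟨_ | ⟨⟨a, b, s⟩, r⟩, h, rfl, rfl⟩
    · obtain ⟨S', q', p', h, -⟩ := h
      cases h
    · obtain ⟨h1, h2⟩ := h
      cases h1 with
      | startTied S => exact .inl (tied_spec h2).2
      | startPad S h =>
        obtain ⟨-, e2, e3, e4, e5⟩ := pad_spec h2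
        exact .inr ⟨e3, e4, e2, e5⟩
  · rintro (h | ⟨h1, h2, h3, h4⟩)
    · obtain ⟨r, h1, rfl, rfl⟩ := exists_tied h
      exact ⟨(none, none, _) :: r, ⟨.startTied _, h1⟩, rfl, rfl⟩
    · obtain ⟨r, h5, rfl, rfl⟩ := exists_pad h1 h2 h3 h4
      exact ⟨(none, none, _) :: r, ⟨.startPad _ h2.mem_level, h5⟩, rfl, rfl⟩

theorem unambiguous_succTransducer : A.succTransducer.Unambiguous := by
  rintro (_ | ⟨⟨a, b, s⟩, r⟩) (_ | ⟨⟨a', b', s'⟩, r'⟩) h h' hi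
  · rfl
  · obtain ⟨S', q', p', h, -⟩ := h
    cases h
  · obtain ⟨S', q', p', h', -⟩ := h'
    cases h'
  · obtain ⟨h1, h2⟩ := h
    obtain ⟨h1', h2'⟩ := h'
    cases h1 with
    | startTied S =>
      cases h1' with
      | startTied S' =>
        replace hi : inputWord r = inputWord r' := hi
        obtain rfl : S = S' := Subtype.ext (by rw [(tied_spec h2).1, (tied_spec h2').1, hi])
        rw [tied_unique h2 h2' hi]
      | startPad S' hS' =>
        replace hi : inputWord r = inputWord r' := hi
        exact absurd (hi ▸ (pad_spec h2').2.2.1) (tied_spec h2).2.not_noneAbove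
    | startPad S hS =>
      cases h1' with
      | startTied S' =>
        replace hi : inputWord r = inputWord r' := hi
        exact absurd (hi ▸ (pad_spec h2).2.2.1) (tied_spec h2').2.not_noneAbove
      | startPad S' hS' =>
        replace hi : inputWord r = inputWord r' := hi
        obtain ⟨e1, e2, -, -, e3⟩ := pad_spec h2
        obtain ⟨e1', e2', -, -, e3'⟩ := pad_spec h2'
        rw [e1] at hS
        rw [e1'] at hS'
        rw [hi] at e2 e3
        -- Both output lengths are the least length above that of the input for which the start
        -- state accepts a word.
        have ho : (outputWord r).length = (outputWord r').length := le_antisymm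
          (not_lt.1 fun hlt => e3 _ e2' hlt hS') (not_lt.1 fun hlt => e3' _ e2 hlt hS)
        obtain rfl : S = S' := Subtype.ext (by rw [e1, e1', ho])
        rw [pad_unique h2 h2' hi ho]

end Runs

end DFA

namespace DFA

/-! ### Counting levels through a common loop length -/

section Loops

variable {α σ : Type*} (A : DFA α σ)

/-- Some word of length `m` leads from `q` back to `q`. -/
def HasLoop (q : σ) (m : ℕ) : Prop := ∃ w : List α, w.length = m ∧ A.evalFrom q w = q

variable {A}

theorem hasLoop_zero (q : σ) : A.HasLoop q 0 := ⟨[], rfl, rfl⟩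

theorem HasLoop.add {q : σ} {m m' : ℕ} (h : A.HasLoop q m) (h' : A.HasLoop q m') :
    A.HasLoop q (m + m') := by
  obtain ⟨w, rfl, hw⟩ := h
  obtain ⟨w', rfl, hw'⟩ := h'
  exact ⟨w ++ w', by simp, by rw [evalFrom_of_append, hw, hw']⟩

theorem HasLoop.mul {q : σ} {m : ℕ} (h : A.HasLoop q m) (t : ℕ) : A.HasLoop q (t * m) := by
  induction t with
  | zero => simpa using hasLoop_zero q
  | succ t ih => simpa [Nat.succ_mul] using ih.add h

theorem hasLoop_of_detour {q u : σ} {g : ℕ} {w w' : List α} (hw : A.evalFrom q w = u)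
    (hw' : A.evalFrom u w' = q) (hg : A.HasLoop u g) :
    A.HasLoop q (w.length + w'.length + g) := by
  obtain ⟨x, rfl, hx⟩ := hg
  refine ⟨w ++ x ++ w', by simp; omega, ?_⟩
  rw [evalFrom_of_append, evalFrom_of_append, hw, hx, hw']

/-- If the detour through `u` has length `d` and `t = d + s`, then `g` detours, one of them extended
by `s` loops at `u`, have total length `g * d + g * s = g * t`. -/
theorem hasLoop_mul_of_detour {q u : σ} {g t : ℕ} {w w' : List α} (hw : A.evalFrom q w = u)
    (hw' : A.evalFrom u w' = q) (hg : A.HasLoop u g) (hpos : 1 ≤ g)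
    (ht : w.length + w'.length ≤ t) : A.HasLoop q (g * t) := by
  obtain ⟨s, rfl⟩ := Nat.exists_eq_add_of_le ht
  obtain ⟨g, rfl⟩ := Nat.exists_eq_add_of_le' hpos
  have h := ((hasLoop_of_detour hw hw' (hasLoop_zero u)).mul g).add
    (hasLoop_of_detour hw hw' (hg.mul s))
  convert h using 1
  ring

variable [Fintype σ]

theorem exists_short_word {q u : σ} {w : List α} (h : A.evalFrom q w = u) :
    ∃ w' : List α, w'.length ≤ Fintype.card σ ∧ A.evalFrom q w' = u := by
  induction hn : w.length using Nat.strong_induction_on generalizing w with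
  | _ n ih =>
    by_cases hle : w.length ≤ Fintype.card σ
    · exact ⟨w, hle, h⟩
    · obtain ⟨p, a, b, c, rfl, -, hb, h1, -, h3⟩ := A.evalFrom_split (le_of_not_ge hle) h
      have hb' := List.length_pos_iff.2 hb
      refine ih _ ?_ (w := a ++ c) (by rw [evalFrom_of_append, h1, h3]) rfl
      rw [← hn]
      simp only [List.length_append]
      omega

/-- An accepted word this long repeats a state; a loop of length `P` is inserted there. -/
theorem level_subset_level_add {P k : ℕ}
    (hP : ∀ q m, 1 ≤ m → A.HasLoop q m → A.HasLoop q P) (hk : Fintype.card σ ≤ k) :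
    A.level k ⊆ A.level (k + P) := by
  rintro q ⟨w, rfl, hw⟩
  obtain ⟨p, a, b, c, rfl, -, hb, h1, h2, h3⟩ := A.evalFrom_split hk rfl
  obtain ⟨x, rfl, hx⟩ := hP p b.length (List.length_pos_iff.2 hb) ⟨b, rfl, h2⟩
  refine ⟨a ++ x ++ b ++ c, by simp; omega, ?_⟩
  rwa [evalFrom_of_append, evalFrom_of_append, evalFrom_of_append, h1, hx, h2, h3]

theorem level_subset_level_add_mul {P k : ℕ}
    (hP : ∀ q m, 1 ≤ m → A.HasLoop q m → A.HasLoop q P) (hk : Fintype.card σ ≤ k) (t : ℕ) :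
    A.level k ⊆ A.level (k + P * t) :=
  level_subset_level_add (fun q m hm h => by simpa [mul_comm] using (hP q m hm h).mul t) hk

theorem level_eq_of_ncard_eq {P k k' : ℕ}
    (hP : ∀ q m, 1 ≤ m → A.HasLoop q m → A.HasLoop q P) (hk : Fintype.card σ ≤ k)
    (hk' : Fintype.card σ ≤ k') (hmod : k % P = k' % P)
    (hcard : (A.level k).ncard = (A.level k').ncard) : A.level k = A.level k' := by
  wlog hle : k ≤ k' generalizing k k'
  · exact (this hk' hk hmod.symm hcard.symm (le_of_not_ge hle)).symm
  obtain ⟨t, ht⟩ : P ∣ k' - k := (Nat.modEq_iff_dvd' hle).1 hmod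
  have h := level_subset_level_add_mul hP hk t
  rw [← ht, Nat.add_sub_cancel' hle] at h
  exact Set.eq_of_subset_of_ncard_le h hcard.ge

theorem ncard_range_level_le {P : ℕ} (hpos : 0 < P)
    (hP : ∀ q m, 1 ≤ m → A.HasLoop q m → A.HasLoop q P) :
    (Set.range A.level).ncard ≤ Fintype.card σ + P * (Fintype.card σ + 1) := by
  classical
  set n := Fintype.card σ
  let good (x : ℕ × ℕ) (k : ℕ) : Prop := n ≤ k ∧ k % P = x.1 ∧ (A.level k).ncard = x.2
  -- A level of index at least `n` is determined by the index mod `P` and its cardinality.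
  let F (x : ℕ × ℕ) : Set σ := if h : ∃ k, good x k then A.level h.choose else ∅
  have hsub : Set.range A.level ⊆
      ↑((Finset.range n).image A.level ∪ (Finset.range P ×ˢ Finset.range (n + 1)).image F) := by
    rintro _ ⟨k, rfl⟩
    simp only [Finset.coe_union, Set.mem_union, Finset.mem_coe, Finset.mem_image,
      Finset.mem_range, Finset.mem_product]
    rcases lt_or_ge k n with hk | hk
    · exact .inl ⟨k, hk, rfl⟩
    · have hex : ∃ k', good (k % P, (A.level k).ncard) k' := ⟨k, hk, rfl, rfl⟩
      refine .inr ⟨(k % P, (A.level k).ncard), ⟨Nat.mod_lt _ hpos, ?_⟩, ?_⟩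
      · exact Nat.lt_succ_iff.2 ((Set.ncard_le_card _).trans Nat.card_eq_fintype_card.le)
      · simp only [F, dif_pos hex]
        exact level_eq_of_ncard_eq hP hex.choose_spec.1 hk hex.choose_spec.2.1 hex.choose_spec.2.2
  calc (Set.range A.level).ncard
      ≤ _ := Set.ncard_le_ncard hsub (Finset.finite_toSet _)
    _ = _ := Set.ncard_coe_finset _
    _ ≤ _ := Finset.card_union_le _ _
    _ ≤ n + P * (n + 1) := by
      refine add_le_add (Finset.card_image_le.trans (by simp)) (Finset.card_image_le.trans ?_)
      simp

end Loops

/-! ### Strongly connected components and the choice of the period -/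

section Components

variable {α σ : Type*} [Fintype σ] (A : DFA α σ)

open Classical in
/-- The strongly connected component of `q`. -/
noncomputable def component (q : σ) : Finset σ :=
  {u | (∃ w, A.evalFrom q w = u) ∧ ∃ w, A.evalFrom u w = q}

open Classical in
/-- The length of some nonempty loop at a state of `C` that is not longer than the size of `C`,
if there is such a loop. -/
noncomputable def loopLength (C : Finset σ) : ℕ :=
  if h : ∃ m, 1 ≤ m ∧ m ≤ C.card ∧ ∃ u ∈ C, A.HasLoop u m then h.choose else 1

variable {A}

theorem mem_component {q u : σ} :
    u ∈ A.component q ↔ (∃ w, A.evalFrom q w = u) ∧ ∃ w, A.evalFrom u w = q := by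
  simp [component]

theorem self_mem_component (q : σ) : q ∈ A.component q :=
  mem_component.2 ⟨⟨[], rfl⟩, [], rfl⟩

theorem component_subset {q u : σ} (h : u ∈ A.component q) : A.component u ⊆ A.component q := by
  obtain ⟨⟨w1, h1⟩, w2, h2⟩ := mem_component.1 h
  intro v hv
  obtain ⟨⟨w3, h3⟩, w4, h4⟩ := mem_component.1 hv
  exact mem_component.2 ⟨⟨w1 ++ w3, by rw [evalFrom_of_append, h1, h3]⟩,
    w4 ++ w2, by rw [evalFrom_of_append, h4, h2]⟩

theorem mem_component_symm {q u : σ} (h : u ∈ A.component q) : q ∈ A.component u :=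
  mem_component.2 (mem_component.1 h).symm

theorem component_eq {q u : σ} (h : u ∈ A.component q) : A.component u = A.component q :=
  (component_subset h).antisymm (component_subset (mem_component_symm h))

-- The default value 1 keeps the product over components positive.
omit [Fintype σ] in
theorem one_le_loopLength (C : Finset σ) : 1 ≤ A.loopLength C := by
  unfold loopLength
  split_ifs with h
  exacts [h.choose_spec.1, le_rfl]

theorem loopLength_component_le (q : σ) :
    A.loopLength (A.component q) ≤ (A.component q).card := by
  unfold loopLength
  split_ifs with h
  exacts [h.choose_spec.2.1, Finset.card_pos.2 ⟨q, self_mem_component q⟩]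

/-- A shortest nonempty loop in the component visits distinct states, all of them in the component.
-/
theorem exists_hasLoop_le_card {q : σ} {m : ℕ} (hm : 1 ≤ m) (h : A.HasLoop q m) :
    ∃ m, 1 ≤ m ∧ m ≤ (A.component q).card ∧ ∃ u ∈ A.component q, A.HasLoop u m := by
  classical
  have hex : ∃ m, 1 ≤ m ∧ ∃ u ∈ A.component q, A.HasLoop u m :=
    ⟨m, hm, q, self_mem_component q, h⟩
  obtain ⟨hpos, u, hu, w, hw, hloop⟩ := Nat.find_spec hex
  refine ⟨Nat.find hex, hpos, ?_, u, hu, w, hw, hloop⟩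
  have htake (i : ℕ) : A.evalFrom u (w.take i) ∈ A.component u :=
    mem_component.2 ⟨⟨_, rfl⟩, w.drop i, by
      rw [← evalFrom_of_append, List.take_append_drop, hloop]⟩
  have hne (i j : ℕ) (hij : i < j) (hj : j < Nat.find hex) :
      A.evalFrom u (w.take i) ≠ A.evalFrom u (w.take j) := by
    intro heq
    -- A repeated state would cut out a shorter nonempty loop, of length `j - i`.
    refine Nat.find_min hex (m := j - i) (by omega) ⟨by omega, A.evalFrom u (w.take i),
      component_subset hu (htake i), (w.take j).drop i, by simp; omega, ?_⟩
    rw [← evalFrom_of_append]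
    conv_rhs => rw [heq, ← List.take_append_drop i (w.take j), List.take_take,
      min_eq_left hij.le]
  calc Nat.find hex = ((Finset.range (Nat.find hex)).image
        fun i => A.evalFrom u (w.take i)).card := by
        rw [Finset.card_image_of_injOn, Finset.card_range]
        intro i hi j hj hij
        simp only [Finset.coe_range, Set.mem_Iio] at hi hj
        by_contra hn
        rcases lt_or_gt_of_ne hn with hlt | hlt
        exacts [hne i j hlt hj hij, hne j i hlt hi hij.symm]
    _ ≤ _ := Finset.card_le_card fun v hv => by
        obtain ⟨i, -, rfl⟩ := Finset.mem_image.1 hv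
        exact component_subset hu (htake i)

/-- The chosen loop sits at some `u` in the component; going from `q` to `u` and back costs at most
`2n` letters by short words. -/
theorem hasLoop_loopLength_mul {q : σ} {m t : ℕ} (hm : 1 ≤ m) (h : A.HasLoop q m)
    (ht : 2 * Fintype.card σ ≤ t) : A.HasLoop q (A.loopLength (A.component q) * t) := by
  have hex := exists_hasLoop_le_card hm h
  obtain ⟨hpos, -, u, hu, hloop⟩ := hex.choose_spec
  rw [loopLength, dif_pos hex]
  obtain ⟨⟨w, hw⟩, w', hw'⟩ := mem_component.1 hu
  obtain ⟨x, hx, hxe⟩ := exists_short_word hw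
  obtain ⟨x', hx', hxe'⟩ := exists_short_word hw'
  exact hasLoop_mul_of_detour hxe hxe' hloop hpos (by omega)

open Classical in
variable (A) in
/-- The strongly connected components of more than `B` states. -/
noncomputable def bigComponents (B : ℕ) : Finset (Finset σ) :=
  {C ∈ Finset.univ.image A.component | B < C.card}

theorem mem_bigComponents {B : ℕ} {C : Finset σ} :
    C ∈ A.bigComponents B ↔ (∃ q, A.component q = C) ∧ B < C.card := by
  simp [bigComponents]

/-- Distinct components are disjoint. -/
theorem card_bigComponents_mul_le (B : ℕ) :
    (A.bigComponents B).card * B ≤ Fintype.card σ := by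
  classical
  have hdisj : (A.bigComponents B : Set (Finset σ)).PairwiseDisjoint id := by
    intro C hC D hD hne
    obtain ⟨⟨q, rfl⟩, -⟩ := mem_bigComponents.1 (Finset.mem_coe.1 hC)
    obtain ⟨⟨q', rfl⟩, -⟩ := mem_bigComponents.1 (Finset.mem_coe.1 hD)
    refine Finset.disjoint_left.2 fun v hv hv' => hne ?_
    exact (component_eq hv).symm.trans (component_eq hv')
  calc (A.bigComponents B).card * B ≤ ∑ C ∈ A.bigComponents B, (id C).card := by
        rw [← smul_eq_mul]
        exact Finset.card_nsmul_le_sum _ _ _ fun C hC => (mem_bigComponents.1 hC).2.le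
    _ = _ := (Finset.card_biUnion hdisj).symm
    _ ≤ _ := Finset.card_le_univ _

open Nat Chebyshev in
theorem exists_ncard_range_level_le (A : DFA α σ) (B : ℕ) :
    ∃ s, s * B ≤ Fintype.card σ ∧ (Set.range A.level).ncard ≤ Fintype.card σ +
      2 * Fintype.card σ * (lcmUpto B * Fintype.card σ ^ s) * (Fintype.card σ + 1) := by
  set n := Fintype.card σ with hn
  have hn0 : 0 < n := Fintype.card_pos_iff.2 ⟨A.start⟩
  set R := ∏ C ∈ A.bigComponents B, A.loopLength C with hR
  have hR0 : 0 < R := Finset.prod_pos fun C _ => one_le_loopLength C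
  have hRle : R ≤ n ^ (A.bigComponents B).card := Finset.prod_le_pow_card _ _ _ fun C hC => by
    obtain ⟨⟨q, rfl⟩, -⟩ := mem_bigComponents.1 hC
    exact (loopLength_component_le q).trans (Finset.card_le_univ _)
  have hL := lcmUpto_pos B
  have hdvd (q : σ) : A.loopLength (A.component q) ∣ lcmUpto B * R := by
    by_cases hq : B < (A.component q).card
    · exact (Finset.dvd_prod_of_mem _ (mem_bigComponents.2 ⟨⟨q, rfl⟩, hq⟩)).mul_left _
    · refine Dvd.dvd.mul_right ?_ _
      exact Finset.dvd_lcm (f := id) (Finset.mem_Icc.2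
        ⟨one_le_loopLength _, (loopLength_component_le q).trans (not_lt.1 hq)⟩)
  refine ⟨_, card_bigComponents_mul_le (A := A) B, ?_⟩
  refine (ncard_range_level_le (P := 2 * n * (lcmUpto B * R)) (by positivity) ?_).trans
    (by gcongr)
  -- The period is `loopLength * (2 * n * s)` with `s > 0`, so its second factor is at least `2 *
  -- n`.
  intro q m hm h
  obtain ⟨s, hs⟩ := hdvd q
  have hs0 : 0 < s := Nat.pos_of_ne_zero fun h0 => by
    rw [h0, mul_zero] at hs
    exact (Nat.mul_pos hL hR0).ne' hs
  rw [hs, mul_left_comm]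
  exact hasLoop_loopLength_mul hm h (Nat.le_mul_of_pos_right _ hs0)

end Components

/-! ### Number of states of the transducer -/

section Count

variable {α σ : Type*} [Fintype σ] (A : DFA α σ)

theorem finite_succState : Finite A.SuccState ∧
    Nat.card A.SuccState ≤ (Set.range A.level).ncard * (Fintype.card σ *
      (Fintype.card σ + 2)) + 1 := by
  let F : A.SuccState → Option (A.Level × σ × Option (Option σ))
    | .start => none
    | .pad S p => some (S, p, none)
    | .tied S q => some (S, q, some none)
    | .split S q p => some (S, q, some (some p))
  have hF : Function.Injective F := by
    rintro (_ | _ | _ | _) (_ | _ | _ | _) h <;> simp_all [F]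
  refine ⟨.of_injective F hF, (Nat.card_le_card_of_injective F hF).trans ?_⟩
  simp [Finite.card_option, Nat.card_coe_set_eq]

end Count

end DFA

/-! ### Renaming of states -/

namespace Transducer

variable {α β σ τ : Type*}

/-- Renames the states of a transducer. -/
def reindex (e : σ ≃ τ) (T : Transducer α β σ) : Transducer α β τ where
  step p a := {t | (e.symm t.1, t.2) ∈ T.step (e.symm p) a}
  start := e T.start
  accept := {p | e.symm p ∈ T.accept}

/-- Renames the states in a sequence of transitions. -/
def mapRun (g : σ → τ) (r : List (Option α × Option β × σ)) : List (Option α × Option β × τ) :=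
  r.map fun t => (t.1, t.2.1, g t.2.2)

@[simp] theorem inputWord_mapRun (g : σ → τ) (r : List (Option α × Option β × σ)) :
    inputWord (mapRun g r) = inputWord r := by
  simp only [inputWord, mapRun, List.filterMap_map]
  rfl

@[simp] theorem outputWord_mapRun (g : σ → τ) (r : List (Option α × Option β × σ)) :
    outputWord (mapRun g r) = outputWord r := by
  simp only [outputWord, mapRun, List.filterMap_map]
  rfl

theorem mapRun_mapRun {g : σ → τ} {h : τ → σ} (hgh : ∀ x, g (h x) = x)
    (r : List (Option α × Option β × τ)) : mapRun g (mapRun h r) = r := by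
  simp [mapRun, Function.comp_def, hgh]

theorem acceptingFrom_reindex (e : σ ≃ τ) (T : Transducer α β σ) (p : τ)
    (r : List (Option α × Option β × τ)) :
    (T.reindex e).AcceptingFrom p r ↔ T.AcceptingFrom (e.symm p) (mapRun e.symm r) := by
  induction r generalizing p with
  | nil => rfl
  | cons t r ih => exact and_congr Iff.rfl (ih _)

theorem acceptingRun_reindex (e : σ ≃ τ) (T : Transducer α β σ)
    (r : List (Option α × Option β × τ)) :
    (T.reindex e).AcceptingRun r ↔ T.AcceptingRun (mapRun e.symm r) := by
  rw [AcceptingRun, acceptingFrom_reindex]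
  simp [reindex, AcceptingRun]

theorem Unambiguous.reindex {T : Transducer α β σ} (h : T.Unambiguous) (e : σ ≃ τ) :
    (T.reindex e).Unambiguous := by
  intro r r' hr hr' hi
  rw [acceptingRun_reindex] at hr hr'
  rw [← mapRun_mapRun e.apply_symm_apply r, ← mapRun_mapRun e.apply_symm_apply r', h _ _ hr hr' (by simpa using hi)]

theorem mapsWord_reindex (e : σ ≃ τ) (T : Transducer α β σ) (u : List α) (v : List β) :
    (T.reindex e).MapsWord u v ↔ T.MapsWord u v := by
  constructor
  · rintro ⟨r, hr, rfl, rfl⟩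
    exact ⟨mapRun e.symm r, (acceptingRun_reindex e T r).1 hr, by simp, by simp⟩
  · rintro ⟨r, hr, rfl, rfl⟩
    refine ⟨mapRun e r, (acceptingRun_reindex e T _).2 ?_, by simp, by simp⟩
    rwa [mapRun_mapRun e.symm_apply_apply]

end Transducer

/-! ### Growth of the state bound -/

section Asymptotics

open Filter Chebyshev

/-- The size of the components that are treated separately in an automaton with `n` states. -/
noncomputable def componentBound (n : ℕ) : ℕ := ⌈√(n * Real.log n)⌉₊ + 1

/-- A bound for the number of states of the successor transducer of an automaton with `n`
states. -/
noncomputable def stateBound (n : ℕ) : ℕ :=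
  16 * n ^ 4 * Nat.lcmUpto (componentBound n) * n ^ (n / componentBound n)

theorem stateBound_pos {n : ℕ} (hn : 0 < n) : 0 < stateBound n := by
  have := Nat.lcmUpto_pos (componentBound n)
  unfold stateBound
  positivity

theorem log_stateBound {n : ℕ} (hn : 0 < n) :
    Real.log (stateBound n) = Real.log 16 + 4 * Real.log n + ψ (componentBound n) +
      (n / componentBound n : ℕ) * Real.log n := by
  have hL : ((Nat.lcmUpto (componentBound n) : ℕ) : ℝ) ≠ 0 :=
    Nat.cast_ne_zero.2 (Nat.lcmUpto_pos _).ne'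
  have hn' : (n : ℝ) ≠ 0 := Nat.cast_ne_zero.2 hn.ne'
  rw [stateBound, psi_eq_log_lcmUpto]
  push_cast
  rw [Real.log_mul (by positivity) (by positivity), Real.log_mul (by positivity) hL,
    Real.log_mul (by norm_num) (by positivity), Real.log_pow, Real.log_pow]
  norm_num

theorem log_stateBound_le {n : ℕ} (hn : 3 ≤ n) :
    Real.log (stateBound n) ≤
      (Real.log 16 + 4 + (Real.log 4 + 4) * 3 + 1) * √(n * Real.log n) := by
  have hn' : (3 : ℝ) ≤ n := by exact_mod_cast hn
  -- This is where `n ≥ 3 > e` enters.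
  have hlog : 1 ≤ Real.log n := by
    rw [Real.le_log_iff_exp_le (by linarith)]
    exact (Real.exp_one_lt_d9.le.trans (by norm_num)).trans hn'
  rw [log_stateBound (by omega)]
  set T := √(n * Real.log n) with hT
  have hTsq : T * T = n * Real.log n := Real.mul_self_sqrt (by positivity)
  have hlogT : Real.log n ≤ T := Real.le_sqrt_of_sq_le (by
    rw [sq]
    exact mul_le_mul_of_nonneg_right (Real.log_le_self (by linarith)) (by linarith))
  have hT1 : 1 ≤ T := hlog.trans hlogT
  -- Rounding up and the extra 1 give at most `T + 2`, and `1 ≤ T`.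
  have hB : (componentBound n : ℝ) ≤ 3 * T := by
    have := Nat.ceil_lt_add_one (a := T) (by linarith)
    rw [componentBound]
    push_cast
    linarith
  have hB' : T ≤ componentBound n := by
    have := Nat.le_ceil T
    rw [componentBound]
    push_cast
    linarith
  have h16 : 0 ≤ Real.log 16 := Real.log_nonneg (by norm_num)
  have h4 : 0 ≤ Real.log 4 := Real.log_nonneg (by norm_num)
  have hpsi : ψ (componentBound n) ≤ (Real.log 4 + 4) * (3 * T) :=
    (psi_le_const_mul_self (Nat.cast_nonneg _)).trans (by gcongr)
  have hdiv : (n / componentBound n : ℕ) * Real.log n ≤ T :=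
    calc (n / componentBound n : ℕ) * Real.log n ≤ n / T * Real.log n := by
          gcongr
          exact Nat.cast_div_le.trans (by gcongr)
      _ = T := by
          rw [div_mul_eq_mul_div, ← hTsq]
          field_simp
  nlinarith [mul_le_mul_of_nonneg_left hT1 h16]

theorem isBigO_logb_stateBound :
    (fun n : ℕ => Real.logb 2 (stateBound n)) =O[atTop]
      fun n : ℕ => √((n : ℝ) * Real.log (n : ℝ)) := by
  refine Asymptotics.IsBigO.of_bound
    ((Real.log 16 + 4 + (Real.log 4 + 4) * 3 + 1) / Real.log 2) ?_
  filter_upwards [eventually_ge_atTop 3] with n hn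
  have h2 : 0 < Real.log 2 := Real.log_pos (by norm_num)
  have h1 : (1 : ℝ) ≤ stateBound n := by exact_mod_cast stateBound_pos (by omega)
  rw [Real.norm_of_nonneg (Real.sqrt_nonneg _),
    Real.norm_of_nonneg (Real.logb_nonneg (by norm_num) h1), Real.logb, div_mul_eq_mul_div]
  gcongr
  exact log_stateBound_le hn

end Asymptotics

theorem DFA.card_succState_le {α σ : Type*} [Fintype σ] (A : DFA α σ) :
    Nat.card A.SuccState ≤ stateBound (Fintype.card σ) := by
  obtain ⟨s, hs, hN⟩ := A.exists_ncard_range_level_le (componentBound (Fintype.card σ))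
  refine A.finite_succState.2.trans ?_
  have hn : 1 ≤ Fintype.card σ := Fintype.card_pos_iff.2 ⟨A.start⟩
  set n := Fintype.card σ
  have hB : 0 < componentBound n := Nat.succ_pos _
  have hL : 1 ≤ Nat.lcmUpto (componentBound n) := Nat.lcmUpto_pos _
  have hs' : n ^ s ≤ n ^ (n / componentBound n) :=
    Nat.pow_le_pow_right hn ((Nat.le_div_iff_mul_le hB).2 hs)
  set R := Nat.lcmUpto (componentBound n) * n ^ (n / componentBound n) with hR
  have hR1 : 1 ≤ R := Nat.mul_pos hL (Nat.pow_pos hn)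
  -- Then `5 n² R` levels times `n (n + 2) ≤ 3 n²`, plus 1 for the initial state, give the constant
  -- 16.
  have hN' : (Set.range A.level).ncard ≤ 5 * n ^ 2 * R :=
    calc (Set.range A.level).ncard ≤ n + 2 * n * R * (n + 1) := hN.trans (by rw [hR]; gcongr)
      _ ≤ n * n * R + 2 * n * R * (n + n) := by
        gcongr
        calc n = n * 1 * 1 := by ring
          _ ≤ n * n * R := by gcongr
      _ = _ := by ring
  calc (Set.range A.level).ncard * (n * (n + 2)) + 1
      ≤ 5 * n ^ 2 * R * (n * (n + 2 * n)) + 1 * 1 * 1 := by gcongr; omega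
    _ ≤ 5 * n ^ 2 * R * (n * (n + 2 * n)) + 1 * n ^ 4 * R := by
        gcongr
        exact Nat.pow_pos hn
    _ = 16 * n ^ 4 * R := by ring
    _ = stateBound n := by rw [stateBound, hR]; ring

theorem mainTheorem6 :
    ∃ f : ℕ → ℝ,
      f =O[Filter.atTop] (fun n : ℕ => Real.sqrt ((n : ℝ) * Real.log (n : ℝ))) ∧
      ∀ (α : Type*) [Fintype α] [LinearOrder α] (σ : Type*) [Fintype σ] (A : DFA α σ),
        ∃ (m : ℕ) (T : Transducer α α (Fin m)),
          (m : ℝ) ≤ (2 : ℝ) ^ f (Fintype.card σ) ∧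
          T.Unambiguous ∧
          ∀ u v : List α, T.MapsWord u v ↔ IsSuccessor A.accepts u v := by
  refine ⟨fun n => Real.logb 2 (stateBound n), isBigO_logb_stateBound, ?_⟩
  intro α _ _ σ _ A
  have := A.finite_succState.1
  refine ⟨Nat.card A.SuccState, A.succTransducer.reindex (Finite.equivFin _), ?_,
    DFA.unambiguous_succTransducer.reindex _, fun u v => ?_⟩
  · have hpos : 0 < stateBound (Fintype.card σ) :=
      stateBound_pos (Fintype.card_pos_iff.2 ⟨A.start⟩)
    rw [Real.rpow_logb (by norm_num) (by norm_num) (by exact_mod_cast hpos)]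
    exact_mod_cast A.card_succState_le
  · rw [Transducer.mapsWord_reindex, DFA.mapsWord_succTransducer]
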